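/- Let $f:\mathbb{R}^n\times\mathbb{R}_{\ge 0}\to\mathbb{R}^n$ be continuous and differentiable in $x$ with $\partial f/\partial x$ continuous on $\mathbb{R}^n\times\mathbb{R}_{\ge 0}$, and let $d:\mathbb{R}_{\ge 0}\to\mathbb{R}^n$ satisfy $\overline{d}=\sup_{t\ge 0}\|d(t)\|<\infty$, where $\|\cdot\|$ is the Euclidean norm. Let $x_1,x_2:\mathbb{R}_{\ge 0}\to\mathbb{R}^n$ be a solution of the unperturbed system $\dot x(t)=f(x(t),t)$ and a solution of the perturbed system $\dot x(t)=f(x(t),t)+d(t)$, respectively, on $t\ge 0$; solutions are understood in the integrated sense $x(t)=x(0)+\int_0^t \dot x(s)\,ds$, with the right-hand side of the system in place of $\dot x$ and integrable on bounded intervals. Suppose that there are a symmetric matrix field $M(x,t)=\Theta(x,t)^{\top}\Theta(x,t)\succ 0$, with $\Theta(x,t)\in\mathbb{R}^{n\times n}$ and $M$ of class $C^1$ on $\mathbb{R}^n\times\mathbb{R}_{\ge 0}$, and constants $\alpha,\underline{\omega},\overline{\omega}\in(0,\infty)$ such that for all $x\in\mathbb{R}^n$ and $t\ge 0$ $$\dot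 M(x,t)+\operatorname{sym}\!\Big(M(x,t)\frac{\partial f}{\partial x}(x,t)\Big)\preceq -2\alpha M(x,t),\qquad \frac{1}{\overline{\omega}}I\preceq M(x,t)\preceq \frac{1}{\underline{\omega}}I,$$ where $\operatorname{sym}(A)=A+A^{\top}$ and $\dot M=\frac{\partial M}{\partial t}+\sum_k \frac{\partial M}{\partial x_k}f_k$. For $t\ge 0$, let $R(t)=\inf_\gamma\int_0^1\|\Theta(\gamma(\mu),t)\,\gamma'(\mu)\|\,d\mu$ and let $\int_{x_1}^{x_2}\|\delta x\|=\inf_\gamma\int_0^1\|\gamma'(\mu)\|\,d\mu$, both infima being over the $C^1$ paths $\gamma:[0,1]\to\mathbb{R}^n$ with $\gamma(0)=x_1(t)$ and $\gamma(1)=x_2(t)$. Then for every $t\ge 0$ $$\int_{x_1}^{x_2}\|\delta x\|-R(0)\sqrt{\overline{\omega}}\,e^{-\alpha t}\;\le\;\frac{\overline{d}}{\alpha}\sqrt{\frac{\overline{\omega}}{\underline{\omega}}}\;\le\;\frac{\overline{d}\,\overline{\omega}}{\alpha\,\underline{\omega}}.$$ The first inequality also holds with $\int_0^1\|\gamma'(\mu)\|\,d\mu$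 in place of $\int_{x_1}^{x_2}\|\delta x\|$ for every such path $\gamma$ that attains the infimum $R(t)$. Consequently $x_2(t)$ lies in the bounded tube $$\|x_2(t)-x_1(t)\|\le R(0)\sqrt{\overline{\omega}}\,e^{-\alpha t}+\frac{\overline{d}}{\alpha}\sqrt{\frac{\overline{\omega}}{\underline{\omega}}}.$$ -/

import Mathlib

open Set MeasureTheory
open scoped Matrix MatrixOrder

noncomputable section

namespace Contraction

/-- The state space `ℝⁿ` with its Euclidean norm. -/
abbrev State (n : ℕ) := EuclideanSpace ℝ (Fin n)

/-- The domain `ℝⁿ × ℝ≥0` of states and times. -/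
def stateTime (n : ℕ) : Set (State n × ℝ) := univ ×ˢ Ici 0

/-- `x` solves `ẋ(t) = f(x(t), t) + d(t)` for `t ≥ 0`, in the integrated (Carathéodory) sense.
If `f` is continuous and `d` is bounded, then every function whose derivative is
`f(x(t), t) + d(t)` at each `t ≥ 0` (one-sided at `0`) is a solution in this sense. -/
def IsSolution {n : ℕ} (f : State n → ℝ → State n) (d : ℝ → State n) (x : ℝ → State n) : Prop :=
  ∀ t : ℝ, 0 ≤ t →
    IntervalIntegrable (fun s => f (x s) s + d s) volume 0 t ∧
      x t = x 0 + ∫ s in (0 : ℝ)..t, (f (x s) s + d s)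

/-- The vector field is continuous on `ℝⁿ × ℝ≥0` and differentiable in the state, and its
derivative with respect to the state is continuous on `ℝⁿ × ℝ≥0`. -/
structure RegularField {n : ℕ} (f : State n → ℝ → State n) : Prop where
  continuousOn : ContinuousOn (fun p : State n × ℝ => f p.1 p.2) (stateTime n)
  differentiable : ∀ t : ℝ, 0 ≤ t → Differentiable ℝ (fun x => f x t)
  continuousOn_fderiv :
    ContinuousOn (fun p : State n × ℝ => fderiv ℝ (fun x => f x p.2) p.1) (stateTime n)

/-- The matrix field `M` has entries of class `C¹` on `ℝⁿ × ℝ≥0`. -/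
def RegularMatrixField {n : ℕ} (M : State n → ℝ → Matrix (Fin n) (Fin n) ℝ) : Prop :=
  ∀ i j, ContDiffOn ℝ 1 (fun p : State n × ℝ => M p.1 p.2 i j) (stateTime n)

/-- The Jacobian matrix `∂f/∂x (x, t)`. -/
def jacobian {n : ℕ} (f : State n → ℝ → State n) (x : State n) (t : ℝ) :
    Matrix (Fin n) (Fin n) ℝ :=
  Matrix.of fun i j => (fderiv ℝ (fun y => f y t) x (EuclideanSpace.single j 1)) i

/-- `Ṁ(x, t) = ∂M/∂t + ∑ₖ (∂M/∂xₖ) fₖ(x, t)`: the derivative of `M` along `ẋ = f(x, t)`, that is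
the derivative of each entry at `(x, t)` in the direction `(f(x, t), 1)`
(one-sided in time at `t = 0`). -/
def totalDeriv {n : ℕ} (f : State n → ℝ → State n)
    (M : State n → ℝ → Matrix (Fin n) (Fin n) ℝ) (x : State n) (t : ℝ) :
    Matrix (Fin n) (Fin n) ℝ :=
  Matrix.of fun i j =>
    fderivWithin ℝ (fun p : State n × ℝ => M p.1 p.2 i j) (stateTime n) (x, t) (f x t, 1)

/-- `sym(A) = A + Aᵀ`. -/
def sym {n : ℕ} (A : Matrix (Fin n) (Fin n) ℝ) : Matrix (Fin n) (Fin n) ℝ := A + Aᵀ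

/-- `γ` restricts to a `C¹` path on `[0, 1]` from `a` to `b`. -/
structure IsPath {n : ℕ} (a b : State n) (γ : ℝ → State n) : Prop where
  contDiffOn : ContDiffOn ℝ 1 γ (Icc 0 1)
  source : γ 0 = a
  target : γ 1 = b

/-- The path integral `∫ N(x, δx)` along `γ`, where `x = γ(μ)` and `δx = γ'(μ) dμ`. -/
def pathIntegral {n : ℕ} (N : State n → State n → ℝ) (γ : ℝ → State n) : ℝ :=
  ∫ μ in (0 : ℝ)..1, N (γ μ) (derivWithin γ (Icc 0 1) μ)

/-- The smallest path integral `∫ₐᵇ N(x, δx)`: the infimum over all `C¹` paths from `a` to `b`. -/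
def smallestPathIntegral {n : ℕ} (N : State n → State n → ℝ) (a b : State n) : ℝ :=
  sInf {L : ℝ | ∃ γ : ℝ → State n, IsPath a b γ ∧ L = pathIntegral N γ}

/-- The integrand `‖δx‖`. -/
def euclideanIntegrand (n : ℕ) : State n → State n → ℝ := fun _ δx => ‖δx‖

/-- The integrand `‖Θ(x, t) δx‖` at the time `t`. -/
def weightedIntegrand {n : ℕ} (Θ : State n → ℝ → Matrix (Fin n) (Fin n) ℝ) (t : ℝ) :
    State n → State n → ℝ :=
  fun x δx => ‖(WithLp.toLp 2 (Θ x t *ᵥ δx.ofLp) : State n)‖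

/-- `R(t) = ∫ ‖Θ(x, t) δx‖`, the smallest such path integral from `x₁(t)` to `x₂(t)`. -/
def R {n : ℕ} (Θ : State n → ℝ → Matrix (Fin n) (Fin n) ℝ) (x₁ x₂ : ℝ → State n) (t : ℝ) : ℝ :=
  smallestPathIntegral (weightedIntegrand Θ t) (x₁ t) (x₂ t)

end Contraction

end

/-! The weighted distance `R` is controlled by Euler steps, without any flow between the two
solutions or minimizing paths. Given `t` and a small `s`, take an almost shortest path from `x₁ t`
to `x₂ t` and move each of its points by `x ↦ x + s • f x t`. A tangent vector `v` becomes `v + s •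
(∂f/∂x) v`, and the derivative at `s = 0` of its squared length is the quadratic form of `Ṁ + sym(M
∂f/∂x)`. By compactness the weighted length therefore shrinks by the factor `1 - (α - η) s` for all
short steps, with one step size for all `t` in `[0, T]` (`exists_eulerEnergy_le`,
`IsPath.pathIntegral_eulerStep_le`).

The endpoints of the moved path miss the true solutions by at most `s η` and `s (D + η)`
(`IsSolution.exists_norm_sub_eulerStep_le`), where `D` bounds `‖d‖`. Joining them by segments costs
a factor `√(1 / ωlow)`, and the triangle inequality gives a one-step recursion for `R`
(`exists_R_add_le`). A discrete Grönwall argument and `η → 0` yield exponential decay up to the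
drift `√(1 / ωlow) * D / α` (`R_le`). Finally, Euclidean length is at most `√ωhigh` times weighted
length. -/

namespace Contraction

/-! ### Path lengths and the distance they define -/

variable {n : ℕ} {N : State n → State n → ℝ} {γ : ℝ → State n} {a b c : State n}

/-- A continuous, nonnegative and positively homogeneous length integrand. -/
structure IsLengthIntegrand (N : State n → State n → ℝ) : Prop where
  continuous : Continuous fun p : State n × State n => N p.1 p.2
  nonneg : ∀ x v, 0 ≤ N x v
  smul : ∀ (r : ℝ), 0 ≤ r → ∀ x v, N x (r • v) = r * N x v

theorem isLengthIntegrand_euclideanIntegrand : IsLengthIntegrand (euclideanIntegrand n) where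
  continuous := continuous_snd.norm
  nonneg _ v := norm_nonneg v
  smul r hr _ v := by simp [euclideanIntegrand, norm_smul, abs_of_nonneg hr]

namespace IsPath

theorem continuousOn (hγ : IsPath a b γ) : ContinuousOn γ (Icc 0 1) :=
  hγ.contDiffOn.continuousOn

theorem continuousOn_derivWithin (hγ : IsPath a b γ) :
    ContinuousOn (derivWithin γ (Icc 0 1)) (Icc 0 1) :=
  hγ.contDiffOn.continuousOn_derivWithin (uniqueDiffOn_Icc zero_lt_one) le_rfl

theorem hasDerivWithinAt (hγ : IsPath a b γ) {μ : ℝ} (hμ : μ ∈ Icc (0 : ℝ) 1) :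
    HasDerivWithinAt γ (derivWithin γ (Icc 0 1) μ) (Icc 0 1) μ :=
  (hγ.contDiffOn.differentiableOn one_ne_zero μ hμ).hasDerivWithinAt

theorem continuousOn_integrand (hN : IsLengthIntegrand N) (hγ : IsPath a b γ) :
    ContinuousOn (fun μ => N (γ μ) (derivWithin γ (Icc 0 1) μ)) (Icc 0 1) :=
  hN.continuous.comp_continuousOn (hγ.continuousOn.prodMk hγ.continuousOn_derivWithin)

theorem intervalIntegrable_integrand (hN : IsLengthIntegrand N) (hγ : IsPath a b γ) :
    IntervalIntegrable (fun μ => N (γ μ) (derivWithin γ (Icc 0 1) μ)) volume 0 1 :=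
  (hγ.continuousOn_integrand hN).intervalIntegrable_of_Icc zero_le_one

end IsPath

theorem pathIntegral_nonneg (hN : IsLengthIntegrand N) (γ : ℝ → State n) :
    0 ≤ pathIntegral N γ :=
  intervalIntegral.integral_nonneg zero_le_one fun _ _ => hN.nonneg _ _

theorem smallestPathIntegral_le (hN : IsLengthIntegrand N) (hγ : IsPath a b γ) :
    smallestPathIntegral N a b ≤ pathIntegral N γ :=
  csInf_le ⟨0, by rintro _ ⟨γ, -, rfl⟩; exact pathIntegral_nonneg hN γ⟩ ⟨γ, hγ, rfl⟩

theorem isPath_segment (a b : State n) : IsPath a b (fun μ => a + μ • (b - a)) where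
  contDiffOn := by fun_prop
  source := by simp
  target := by simp

theorem derivWithin_segment (a b : State n) {μ : ℝ} (hμ : μ ∈ Icc (0 : ℝ) 1) :
    derivWithin (fun μ : ℝ => a + μ • (b - a)) (Icc 0 1) μ = b - a := by
  have h : HasDerivAt (fun μ : ℝ => a + μ • (b - a)) ((1 : ℝ) • (b - a)) μ :=
    ((hasDerivAt_id μ).smul_const (b - a)).const_add a
  rw [one_smul] at h
  exact h.hasDerivWithinAt.derivWithin (uniqueDiffOn_Icc zero_lt_one μ hμ)

/-- The segment makes the set of lengths nonempty; for an empty set `sInf` would take its default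
value `0`. -/
theorem exists_isPath_pathIntegral_lt {r : ℝ} (h : smallestPathIntegral N a b < r) :
    ∃ γ, IsPath a b γ ∧ pathIntegral N γ < r := by
  obtain ⟨_, ⟨γ, hγ, rfl⟩, hlt⟩ :=
    exists_lt_of_csInf_lt (⟨_, _, isPath_segment a b, rfl⟩ :
      {L : ℝ | ∃ γ : ℝ → State n, IsPath a b γ ∧ L = pathIntegral N γ}.Nonempty) h
  exact ⟨γ, hγ, hlt⟩

theorem le_smallestPathIntegral {r : ℝ} (h : ∀ γ, IsPath a b γ → r ≤ pathIntegral N γ) :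
    r ≤ smallestPathIntegral N a b := by
  by_contra! hlt
  obtain ⟨γ, hγ, hγr⟩ := exists_isPath_pathIntegral_lt hlt
  exact (h γ hγ).not_gt hγr

/-- The segment is the competitor. This turns Euclidean errors at the endpoints into weighted
lengths. -/
theorem smallestPathIntegral_le_mul_norm (hN : IsLengthIntegrand N) {C : ℝ}
    (hC : ∀ x v, N x v ≤ C * ‖v‖) (a b : State n) :
    smallestPathIntegral N a b ≤ C * ‖b - a‖ := by
  refine (smallestPathIntegral_le hN (isPath_segment a b)).trans ?_
  calc pathIntegral N (fun μ => a + μ • (b - a)) ≤ ∫ _ in (0 : ℝ)..1, C * ‖b - a‖ := by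
        refine intervalIntegral.integral_mono_on zero_le_one
          ((isPath_segment a b).intervalIntegrable_integrand hN) (by simp) fun μ hμ => ?_
        rw [derivWithin_segment a b hμ]
        exact hC _ _
    _ = C * ‖b - a‖ := by simp

theorem IsPath.pathIntegral_mono {N' : State n → State n → ℝ} (hN : IsLengthIntegrand N)
    (hN' : IsLengthIntegrand N') (hγ : IsPath a b γ) {C : ℝ} (hC : ∀ x v, N x v ≤ C * N' x v) :
    pathIntegral N γ ≤ C * pathIntegral N' γ := by
  rw [pathIntegral, pathIntegral, ← intervalIntegral.integral_const_mul]
  exact intervalIntegral.integral_mono_on zero_le_one (hγ.intervalIntegrable_integrand hN)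
    ((hγ.intervalIntegrable_integrand hN').const_mul C) fun μ _ => hC _ _

/-- A path of Euclidean length `L` stays within distance `L` of its starting point. -/
theorem IsPath.norm_sub_le (hγ : IsPath a b γ) {μ : ℝ} (hμ : μ ∈ Icc (0 : ℝ) 1) :
    ‖γ μ - a‖ ≤ pathIntegral (euclideanIntegrand n) γ := by
  have hint : IntervalIntegrable (derivWithin γ (Icc 0 1)) volume 0 1 :=
    hγ.continuousOn_derivWithin.intervalIntegrable_of_Icc zero_le_one
  have hsub : uIcc (0 : ℝ) μ ⊆ uIcc 0 1 := by
    rw [uIcc_of_le hμ.1, uIcc_of_le zero_le_one]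
    exact Icc_subset_Icc_right hμ.2
  have hftc : ∫ s in (0 : ℝ)..μ, derivWithin γ (Icc 0 1) s = γ μ - γ 0 := by
    refine intervalIntegral.integral_eq_sub_of_hasDerivAt_of_le hμ.1
      (hγ.continuousOn.mono (Icc_subset_Icc_right hμ.2)) (fun s hs => ?_) (hint.mono_set hsub)
    exact (hγ.hasDerivWithinAt ⟨hs.1.le, hs.2.le.trans hμ.2⟩).hasDerivAt
      (Icc_mem_nhds hs.1 (hs.2.trans_le hμ.2))
  rw [← hγ.source, ← hftc]
  refine (intervalIntegral.norm_integral_le_integral_norm hμ.1).trans ?_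
  exact intervalIntegral.integral_mono_interval le_rfl hμ.1 hμ.2
    (Filter.Eventually.of_forall fun _ => norm_nonneg _) hint.norm

theorem norm_sub_le_smallestPathIntegral (a b : State n) :
    ‖b - a‖ ≤ smallestPathIntegral (euclideanIntegrand n) a b :=
  le_smallestPathIntegral fun γ hγ => by
    simpa [hγ.target] using hγ.norm_sub_le (right_mem_Icc.2 zero_le_one)

/-- Reparametrizing a path by a monotone function leaves its path integral unchanged. -/
theorem IsPath.integral_reparam (hN : IsLengthIntegrand N) (hγ : IsPath a b γ) {ψ : ℝ → ℝ}
    (hψ : ContDiff ℝ 1 ψ) (hmono : Monotone ψ) (hψI : ∀ s, ψ s ∈ Icc (0 : ℝ) 1) {u v : ℝ}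
    (huv : u ≤ v) (hu : 0 ≤ u) (hv : v ≤ 1) (hψu : ψ u = 0) (hψv : ψ v = 1)
    {Γ : ℝ → State n} (hΓ : ∀ s ∈ Ioo u v, Γ s = γ (ψ s)) :
    ∫ s in u..v, N (Γ s) (derivWithin Γ (Icc 0 1) s) = pathIntegral N γ := by
  have hcd : Continuous (deriv ψ) := hψ.continuous_deriv le_rfl
  have hψd (s) : HasDerivAt ψ (deriv ψ s) s :=
    (hψ.differentiable one_ne_zero s).hasDerivAt
  have key := intervalIntegral.integral_comp_mul_deriv'' (a := u) (b := v) (f := ψ)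
    (f' := deriv ψ) (g := fun μ => N (γ μ) (derivWithin γ (Icc 0 1) μ)) hψ.continuous.continuousOn
    (fun s _ => (hψd s).hasDerivWithinAt) hcd.continuousOn
    ((hγ.continuousOn_integrand hN).mono (by rintro _ ⟨s, -, rfl⟩; exact hψI s))
  rw [hψu, hψv] at key
  rw [pathIntegral, ← key]
  refine intervalIntegral.integral_congr_uIoo fun s hs => ?_
  rw [uIoo_of_le huv] at hs
  have hΓs : HasDerivAt Γ (deriv ψ s • derivWithin γ (Icc 0 1) (ψ s)) s := by
    -- All values of `ψ` lie in `[0, 1]`, so the chain rule needs only the derivative of `γ` within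
    -- `[0, 1]`.
    refine ((hγ.hasDerivWithinAt (hψI s)).scomp_hasDerivAt s (hψd s) hψI).congr_of_eventuallyEq ?_
    filter_upwards [Ioo_mem_nhds hs.1 hs.2] with r hr using hΓ r hr
  have hsI : s ∈ Icc (0 : ℝ) 1 := ⟨hu.trans hs.1.le, hs.2.le.trans hv⟩
  have hd := hΓs.hasDerivWithinAt.derivWithin (uniqueDiffOn_Icc zero_lt_one s hsI)
  simp only [Function.comp_apply, hd, hΓ s hs, hN.smul _ (hmono.deriv_nonneg), mul_comm]

/-- Plain concatenation is only piecewise `C¹`. Smooth transitions bring each path to rest at the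
junction; on each half one of the two terms is constantly `b`, which the subtraction cancels. -/
theorem IsPath.exists_trans (hN : IsLengthIntegrand N) {γ₁ γ₂ : ℝ → State n}
    (h₁ : IsPath a b γ₁) (h₂ : IsPath b c γ₂) :
    ∃ γ, IsPath a c γ ∧ pathIntegral N γ = pathIntegral N γ₁ + pathIntegral N γ₂ := by
  set ψ₁ : ℝ → ℝ := fun s => Real.smoothTransition (2 * s)
  set ψ₂ : ℝ → ℝ := fun s => Real.smoothTransition (2 * s - 1)
  have hI₁ (s) : ψ₁ s ∈ Icc (0 : ℝ) 1 :=
    ⟨Real.smoothTransition.nonneg _, Real.smoothTransition.le_one _⟩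
  have hI₂ (s) : ψ₂ s ∈ Icc (0 : ℝ) 1 :=
    ⟨Real.smoothTransition.nonneg _, Real.smoothTransition.le_one _⟩
  have hst : ContDiff ℝ 1 Real.smoothTransition := Real.smoothTransition.contDiff (n := 1)
  have hc₁ : ContDiff ℝ 1 ψ₁ := hst.comp (by fun_prop)
  have hc₂ : ContDiff ℝ 1 ψ₂ := hst.comp (by fun_prop)
  have hm₁ : Monotone ψ₁ := fun s t h => Real.smoothTransition.monotone (by linarith)
  have hm₂ : Monotone ψ₂ := fun s t h => Real.smoothTransition.monotone (by linarith)
  have hone₁ {s : ℝ} (hs : 1 / 2 ≤ s) : ψ₁ s = 1 :=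
    Real.smoothTransition.one_of_one_le (by linarith)
  have hzero₂ {s : ℝ} (hs : s ≤ 1 / 2) : ψ₂ s = 0 :=
    Real.smoothTransition.zero_of_nonpos (by linarith)
  have hzero₁ : ψ₁ 0 = 0 := Real.smoothTransition.zero_of_nonpos (by simp)
  have hone₂ : ψ₂ 1 = 1 := Real.smoothTransition.one_of_one_le (by norm_num)
  have hΓ : IsPath a c (fun s => γ₁ (ψ₁ s) + γ₂ (ψ₂ s) - b) := by
    refine ⟨?_, ?_, ?_⟩
    · exact ((h₁.contDiffOn.comp hc₁.contDiffOn fun s _ => hI₁ s).add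
        (h₂.contDiffOn.comp hc₂.contDiffOn fun s _ => hI₂ s)).sub contDiffOn_const
    · simp [hzero₁, hzero₂, h₁.source, h₂.source]
    · simp [hone₂, hone₁ (s := 1) (by norm_num), h₁.target, h₂.target]
  refine ⟨_, hΓ, ?_⟩
  have hint := hΓ.intervalIntegrable_integrand hN
  rw [pathIntegral, ← intervalIntegral.integral_add_adjacent_intervals (b := 1 / 2)
    (hint.mono_set (by
      rw [uIcc_of_le (by norm_num), uIcc_of_le zero_le_one]
      exact Icc_subset_Icc_right (by norm_num)))
    (hint.mono_set (by
      rw [uIcc_of_le (by norm_num), uIcc_of_le zero_le_one]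
      exact Icc_subset_Icc_left (by norm_num))),
    h₁.integral_reparam hN hc₁ hm₁ hI₁ (by norm_num) le_rfl (by norm_num) hzero₁ (hone₁ le_rfl)
      fun s hs => by simp [hzero₂ hs.2.le, h₂.source],
    h₂.integral_reparam hN hc₂ hm₂ hI₂ (by norm_num) (by norm_num) le_rfl (hzero₂ le_rfl) hone₂
      fun s hs => by simp [hone₁ hs.1.le, h₁.target]]

theorem smallestPathIntegral_triangle (hN : IsLengthIntegrand N) (a b c : State n) :
    smallestPathIntegral N a c ≤ smallestPathIntegral N a b + smallestPathIntegral N b c := by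
  refine le_of_forall_pos_lt_add fun ε hε => ?_
  obtain ⟨γ₁, h₁, hlt₁⟩ := exists_isPath_pathIntegral_lt
    (show smallestPathIntegral N a b < smallestPathIntegral N a b + ε / 2 by linarith)
  obtain ⟨γ₂, h₂, hlt₂⟩ := exists_isPath_pathIntegral_lt
    (show smallestPathIntegral N b c < smallestPathIntegral N b c + ε / 2 by linarith)
  obtain ⟨γ, hγ, heq⟩ := h₁.exists_trans hN h₂
  linarith [smallestPathIntegral_le hN hγ]

end Contraction

/-! ### Squared lengths of tangent vectors under an Euler step -/

namespace Contraction

variable {n : ℕ} {f : State n → ℝ → State n} {M Θ : State n → ℝ → Matrix (Fin n) (Fin n) ℝ}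

theorem dotProduct_mulVec_mono {A B : Matrix (Fin n) (Fin n) ℝ} (h : A ≤ B) (v : Fin n → ℝ) :
    v ⬝ᵥ A *ᵥ v ≤ v ⬝ᵥ B *ᵥ v := by
  have := (Matrix.le_iff.1 h).dotProduct_mulVec_nonneg v
  rw [Matrix.sub_mulVec, dotProduct_sub, star_trivial] at this
  linarith

theorem dotProduct_smul_one_mulVec (r : ℝ) (v : State n) :
    v.ofLp ⬝ᵥ (r • (1 : Matrix (Fin n) (Fin n) ℝ)) *ᵥ v.ofLp = r * ‖v‖ ^ 2 := by
  rw [Matrix.smul_mulVec, Matrix.one_mulVec, dotProduct_smul, smul_eq_mul,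
    EuclideanSpace.real_norm_sq_eq]
  simp [dotProduct, sq]

theorem jacobian_mulVec (x : State n) (t : ℝ) (v : State n) :
    jacobian f x t *ᵥ v.ofLp = (fderiv ℝ (fun y => f y t) x v).ofLp := by
  conv_rhs => rw [← (EuclideanSpace.basisFun (Fin n) ℝ).sum_repr v]
  ext i
  simp [jacobian, Matrix.mulVec, dotProduct, mul_comm]

theorem uniqueDiffOn_stateTime : UniqueDiffOn ℝ (stateTime n) :=
  uniqueDiffOn_univ.prod (uniqueDiffOn_Ici 0)

theorem mk_mem_stateTime {x : State n} {t : ℝ} (ht : 0 ≤ t) : (x, t) ∈ stateTime n :=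
  ⟨mem_univ _, ht⟩

/-- The derivative of the entries of `M` at the point `p` in the direction `w`. -/
noncomputable def dirDeriv (M : State n → ℝ → Matrix (Fin n) (Fin n) ℝ) (p w : State n × ℝ) :
    Matrix (Fin n) (Fin n) ℝ :=
  Matrix.of fun i j => fderivWithin ℝ (fun q : State n × ℝ => M q.1 q.2 i j) (stateTime n) p w

/-- The squared length at time `t + s` of the image of the tangent vector `v` at `x` under the
Euler step `x ↦ x + s • f x t`. -/
noncomputable def eulerEnergy (f : State n → ℝ → State n) (M : State n → ℝ → Matrix (Fin n) (Fin n) ℝ)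
    (x : State n) (t : ℝ) (v : State n) (s : ℝ) : ℝ :=
  (v + s • fderiv ℝ (fun y => f y t) x v).ofLp ⬝ᵥ
    M (x + s • f x t) (t + s) *ᵥ (v + s • fderiv ℝ (fun y => f y t) x v).ofLp

/-- The derivative of `eulerEnergy` in the step size. -/
noncomputable def eulerEnergyDeriv (f : State n → ℝ → State n) (M : State n → ℝ → Matrix (Fin n) (Fin n) ℝ)
    (x : State n) (t : ℝ) (v : State n) (s : ℝ) : ℝ :=
  (fderiv ℝ (fun y => f y t) x v).ofLp ⬝ᵥ
      M (x + s • f x t) (t + s) *ᵥ (v + s • fderiv ℝ (fun y => f y t) x v).ofLp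
    + (v + s • fderiv ℝ (fun y => f y t) x v).ofLp ⬝ᵥ
      dirDeriv M (x + s • f x t, t + s) (f x t, 1) *ᵥ
        (v + s • fderiv ℝ (fun y => f y t) x v).ofLp
    + (v + s • fderiv ℝ (fun y => f y t) x v).ofLp ⬝ᵥ
      M (x + s • f x t) (t + s) *ᵥ (fderiv ℝ (fun y => f y t) x v).ofLp

theorem eulerEnergy_zero (x : State n) (t : ℝ) (v : State n) :
    eulerEnergy f M x t v 0 = v.ofLp ⬝ᵥ M x t *ᵥ v.ofLp := by
  simp [eulerEnergy]

theorem hasDerivAt_eulerEnergy (hM : RegularMatrixField M) (x v : State n) {t s : ℝ} (ht : 0 ≤ t)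
    (hs : 0 < s) :
    HasDerivAt (eulerEnergy f M x t v) (eulerEnergyDeriv f M x t v s) s := by
  set u : State n := fderiv ℝ (fun y => f y t) x v with hu
  -- Since `t + s > 0`, the point is interior to the domain, so the derivative within it is a
  -- genuine one.
  have hnhds : stateTime n ∈ nhds (x + s • f x t, t + s) :=
    prod_mem_nhds Filter.univ_mem (Ici_mem_nhds (by linarith))
  have hline : HasDerivAt (fun r : ℝ => ((x + r • f x t, t + r) : State n × ℝ)) (f x t, 1) s := by
    have h₁ := ((hasDerivAt_id s).smul_const (f x t)).const_add x
    rw [one_smul] at h₁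
    exact h₁.prodMk ((hasDerivAt_id s).const_add t)
  have hMd (i j) : HasDerivAt (fun r => M (x + r • f x t) (t + r) i j)
      (dirDeriv M (x + s • f x t, t + s) (f x t, 1) i j) s :=
    (((hM i j).differentiableOn one_ne_zero _
      (mem_of_mem_nhds hnhds)).hasFDerivWithinAt.hasFDerivAt hnhds).comp_hasDerivAt (𝕜 := ℝ)
      (f := fun r : ℝ => ((x + r • f x t, t + r) : State n × ℝ)) s hline
  have hv (i) : HasDerivAt (fun r : ℝ => (v + r • u).ofLp i) (u.ofLp i) s := by
    have := ((hasDerivAt_id s).mul_const (u.ofLp i)).const_add (v.ofLp i)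
    simpa using this
  have h : HasDerivAt (fun r => ∑ i, (v + r • u).ofLp i *
      ∑ j, M (x + r • f x t) (t + r) i j * (v + r • u).ofLp j) _ s :=
    HasDerivAt.fun_sum fun i _ => (hv i).fun_mul
      (HasDerivAt.fun_sum fun j _ => (hMd i j).fun_mul (hv j))
  refine h.congr_deriv ?_
  simp only [eulerEnergyDeriv, ← hu, dotProduct, Matrix.mulVec, Finset.sum_add_distrib, mul_add]
  ring

theorem continuousOn_dotProduct_mulVec {X : Type*} [TopologicalSpace X] {s : Set X}
    {u v : X → State n} {A : X → Matrix (Fin n) (Fin n) ℝ} (hu : ContinuousOn u s)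
    (hA : ∀ i j, ContinuousOn (fun x => A x i j) s) (hv : ContinuousOn v s) :
    ContinuousOn (fun x => (u x).ofLp ⬝ᵥ A x *ᵥ (v x).ofLp) s := by
  have hu' (i) : ContinuousOn (fun x => (u x).ofLp i) s := by fun_prop
  have hv' (i) : ContinuousOn (fun x => (v x).ofLp i) s := by fun_prop
  simp only [dotProduct, Matrix.mulVec]
  exact continuousOn_finsetSum _ fun i _ => (hu' i).mul
    (continuousOn_finsetSum _ fun j _ => (hA i j).mul (hv' j))

theorem continuousOn_eulerEnergyDeriv (hf : RegularField f) (hM : RegularMatrixField M) :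
    ContinuousOn (fun p : (State n × ℝ) × State n × ℝ =>
        eulerEnergyDeriv f M p.1.1 p.1.2 p.2.1 p.2.2) (stateTime n ×ˢ univ ×ˢ Ici 0) := by
  set S : Set ((State n × ℝ) × State n × ℝ) := stateTime n ×ˢ univ ×ˢ Ici 0
  have hfS : ContinuousOn (fun p : (State n × ℝ) × State n × ℝ => f p.1.1 p.1.2) S :=
    hf.continuousOn.comp continuousOn_fst fun p hp => hp.1
  have hJ : ContinuousOn (fun p : (State n × ℝ) × State n × ℝ =>
      fderiv ℝ (fun y => f y p.1.2) p.1.1 p.2.1) S :=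
    (hf.continuousOn_fderiv.comp continuousOn_fst fun p hp => hp.1).clm_apply
      continuous_snd.fst.continuousOn
  have hv : ContinuousOn (fun p : (State n × ℝ) × State n × ℝ =>
      p.2.1 + p.2.2 • fderiv ℝ (fun y => f y p.1.2) p.1.1 p.2.1) S :=
    continuous_snd.fst.continuousOn.add (continuous_snd.snd.continuousOn.smul hJ)
  have hpt : ContinuousOn (fun p : (State n × ℝ) × State n × ℝ =>
      ((p.1.1 + p.2.2 • f p.1.1 p.1.2, p.1.2 + p.2.2) : State n × ℝ)) S :=
    (continuous_fst.fst.continuousOn.add (continuous_snd.snd.continuousOn.smul hfS)).prodMk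
      (by fun_prop)
  have hmaps : MapsTo (fun p : (State n × ℝ) × State n × ℝ =>
      ((p.1.1 + p.2.2 • f p.1.1 p.1.2, p.1.2 + p.2.2) : State n × ℝ)) S (stateTime n) :=
    fun p hp => mk_mem_stateTime (add_nonneg hp.1.2 hp.2.2)
  have hMS (i j) : ContinuousOn (fun p : (State n × ℝ) × State n × ℝ =>
      M (p.1.1 + p.2.2 • f p.1.1 p.1.2) (p.1.2 + p.2.2) i j) S :=
    (hM i j).continuousOn.comp hpt hmaps
  have hDS (i j) : ContinuousOn (fun p : (State n × ℝ) × State n × ℝ =>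
      dirDeriv M (p.1.1 + p.2.2 • f p.1.1 p.1.2, p.1.2 + p.2.2) (f p.1.1 p.1.2, 1) i j) S :=
    (((hM i j).continuousOn_fderivWithin uniqueDiffOn_stateTime le_rfl).comp hpt hmaps).clm_apply
      (hfS.prodMk continuousOn_const)
  exact ((continuousOn_dotProduct_mulVec hJ hMS hv).add
    (continuousOn_dotProduct_mulVec hv hDS hv)).add (continuousOn_dotProduct_mulVec hv hMS hJ)

theorem continuousOn_eulerEnergy (hM : RegularMatrixField M) (x v : State n) {t : ℝ}
    (ht : 0 ≤ t) : ContinuousOn (eulerEnergy f M x t v) (Ici 0) := by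
  refine continuousOn_dotProduct_mulVec (by fun_prop) (fun i j => ?_) (by fun_prop)
  exact (hM i j).continuousOn.comp
    (f := fun s : ℝ => ((x + s • f x t, t + s) : State n × ℝ)) (by fun_prop)
    fun s hs => mk_mem_stateTime (add_nonneg ht hs)

/-- Homogeneity reduces estimates over all tangent vectors to the compact unit sphere. -/
theorem eulerEnergy_smul (x v : State n) (t r s : ℝ) :
    eulerEnergy f M x t (r • v) s = r ^ 2 * eulerEnergy f M x t v s := by
  have h : r • v + s • fderiv ℝ (fun y => f y t) x (r • v)
      = r • (v + s • fderiv ℝ (fun y => f y t) x v) := by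
    rw [map_smul, smul_add, smul_comm]
  rw [eulerEnergy, h, WithLp.ofLp_smul, Matrix.mulVec_smul, smul_dotProduct, dotProduct_smul,
    eulerEnergy, smul_eq_mul, smul_eq_mul]
  ring

/-- At step size zero the three terms add up to the quadratic form of the left side of `hcontr`;
symmetry of `M` identifies the transposed term. -/
theorem eulerEnergyDeriv_zero_le {x : State n} {t α : ℝ} (hsymm : (M x t)ᵀ = M x t)
    (hcontr : totalDeriv f M x t + sym (M x t * jacobian f x t) ≤ -(2 * α) • M x t)
    (v : State n) :
    eulerEnergyDeriv f M x t v 0 ≤ -(2 * α) * (v.ofLp ⬝ᵥ M x t *ᵥ v.ofLp) := by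
  have h := dotProduct_mulVec_mono hcontr v.ofLp
  rw [Matrix.smul_mulVec, dotProduct_smul, smul_eq_mul, Matrix.add_mulVec, dotProduct_add, sym,
    Matrix.add_mulVec, dotProduct_add, Matrix.transpose_mul, hsymm, ← Matrix.mulVec_mulVec,
    ← Matrix.mulVec_mulVec, jacobian_mulVec, Matrix.dotProduct_mulVec v.ofLp (jacobian f x t)ᵀ,
    Matrix.vecMul_transpose, jacobian_mulVec] at h
  refine le_trans (le_of_eq ?_) h
  simp only [eulerEnergyDeriv, zero_smul, add_zero, dirDeriv, totalDeriv]
  ring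

/-- On compact sets an Euler step contracts squared lengths at a rate arbitrarily close to `2 α`,
uniformly in the base point and in the tangent vector. -/
theorem exists_eulerEnergy_le (hf : RegularField f) (hM : RegularMatrixField M)
    (hsymm : ∀ x t, 0 ≤ t → (M x t)ᵀ = M x t) {α ω : ℝ} (hω : 0 < ω)
    (hcontr : ∀ x t, 0 ≤ t →
      totalDeriv f M x t + sym (M x t * jacobian f x t) ≤ -(2 * α) • M x t)
    (hlower : ∀ x t, 0 ≤ t → (1 / ω) • (1 : Matrix (Fin n) (Fin n) ℝ) ≤ M x t)
    {K : Set (State n)} (hK : IsCompact K) (T : ℝ) {η : ℝ} (hη : 0 < η) :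
    ∃ δ > 0, ∀ t ∈ Icc 0 T, ∀ x ∈ K, ∀ v, ∀ s ∈ Icc 0 δ,
      eulerEnergy f M x t v s ≤ (1 - 2 * (α - η) * s) * (v.ofLp ⬝ᵥ M x t *ᵥ v.ofLp) := by
  have hcomp : IsCompact ((K ×ˢ Icc 0 T) ×ˢ Metric.sphere (0 : State n) 1 ×ˢ Icc (0 : ℝ) 1) :=
    (hK.prod isCompact_Icc).prod ((isCompact_sphere 0 1).prod isCompact_Icc)
  have huc := hcomp.uniformContinuousOn_of_continuous
    ((continuousOn_eulerEnergyDeriv hf hM).mono (prod_mono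
      (prod_mono (subset_univ K) Icc_subset_Ici_self)
      (prod_mono (subset_univ (Metric.sphere 0 1)) Icc_subset_Ici_self)))
  -- On unit vectors the form of `M` is at least `1 / ω`, so an error `2 * η / ω` in the derivative
  -- costs at most `2 * η` in the rate.
  obtain ⟨δ, hδ, huc⟩ := Metric.uniformContinuousOn_iff.1 huc (2 * η / ω) (by positivity)
  refine ⟨min 1 (δ / 2), by positivity, fun t ht x hx v s hs => ?_⟩
  have hunit (v : State n) (hv : ‖v‖ = 1) : eulerEnergy f M x t v s
      ≤ (1 - 2 * (α - η) * s) * (v.ofLp ⬝ᵥ M x t *ᵥ v.ofLp) := by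
    rcases hs.1.eq_or_lt with rfl | hs0
    · simp [eulerEnergy_zero]
    -- Mean value theorem: the derivative at `r` differs from that at `0` by less than the
    -- tolerance.
    obtain ⟨r, hr, hslope⟩ := exists_hasDerivAt_eq_slope _ _ hs0
      ((continuousOn_eulerEnergy (f := f) hM x v ht.1).mono Icc_subset_Ici_self)
      fun r hr => hasDerivAt_eulerEnergy hM x v ht.1 hr.1
    have hr1 : r ≤ 1 := hr.2.le.trans (hs.2.trans (min_le_left _ _))
    have hrδ : r < δ := by
      have := hs.2.trans (min_le_right _ _)
      linarith [hr.2]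
    have hclose := huc ((x, t), v, r)
      ⟨⟨hx, ht⟩, by simpa using hv, hr.1.le, hr1⟩ ((x, t), v, 0)
      ⟨⟨hx, ht⟩, by simpa using hv, le_rfl, zero_le_one⟩
      (by simp [Prod.dist_eq, abs_of_pos hr.1, hrδ, hδ])
    rw [Real.dist_eq] at hclose
    have hzero := eulerEnergyDeriv_zero_le (hsymm x t ht.1) (hcontr x t ht.1) v
    have hq := dotProduct_mulVec_mono (hlower x t ht.1) v.ofLp
    rw [dotProduct_smul_one_mulVec, hv] at hq
    rw [eulerEnergy_zero, sub_zero, eq_div_iff hs0.ne'] at hslope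
    have hηq : 2 * η / ω ≤ 2 * η * (v.ofLp ⬝ᵥ M x t *ᵥ v.ofLp) := by
      rw [div_eq_mul_one_div]
      exact mul_le_mul_of_nonneg_left (by linarith) (by linarith)
    have hd : eulerEnergyDeriv f M x t v r ≤ -(2 * (α - η)) * (v.ofLp ⬝ᵥ M x t *ᵥ v.ofLp) := by
      linarith [(abs_lt.1 hclose).2]
    linarith [mul_le_mul_of_nonneg_right hd hs0.le]
  rcases eq_or_ne v 0 with rfl | hv
  · simp [eulerEnergy]
  obtain ⟨r, w, hw, rfl⟩ : ∃ (r : ℝ) (w : State n), ‖w‖ = 1 ∧ v = r • w := by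
    have hv' : ‖v‖ ≠ 0 := norm_ne_zero_iff.2 hv
    refine ⟨‖v‖, ‖v‖⁻¹ • v, ?_, ?_⟩
    · rw [norm_smul, norm_inv, norm_norm, inv_mul_cancel₀ hv']
    · rw [smul_smul, mul_inv_cancel₀ hv', one_smul]
  rw [← eulerEnergy_zero (f := f), eulerEnergy_smul, eulerEnergy_smul, eulerEnergy_zero,
    mul_left_comm]
  exact mul_le_mul_of_nonneg_left (hunit w hw) (sq_nonneg _)

end Contraction

/-! ### Weighted lengths of paths under an Euler step -/

namespace Contraction

variable {n : ℕ} {f : State n → ℝ → State n} {M Θ : State n → ℝ → Matrix (Fin n) (Fin n) ℝ}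

theorem weightedIntegrand_sq {t : ℝ} {x : State n} (hMΘ : M x t = (Θ x t)ᵀ * Θ x t)
    (v : State n) : weightedIntegrand Θ t x v ^ 2 = v.ofLp ⬝ᵥ M x t *ᵥ v.ofLp := by
  rw [weightedIntegrand, EuclideanSpace.real_norm_sq_eq, hMΘ, ← Matrix.mulVec_mulVec,
    Matrix.dotProduct_mulVec, Matrix.vecMul_transpose]
  simp [dotProduct, sq]

/-- `Θ` is not assumed continuous. The integrand depends on it only through `M`, whose regularity
supplies continuity. -/
theorem weightedIntegrand_eq_sqrt {t : ℝ} {x : State n} (hMΘ : M x t = (Θ x t)ᵀ * Θ x t)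
    (v : State n) : weightedIntegrand Θ t x v = √(v.ofLp ⬝ᵥ M x t *ᵥ v.ofLp) := by
  rw [← weightedIntegrand_sq hMΘ]
  exact (Real.sqrt_sq (norm_nonneg _)).symm

theorem isLengthIntegrand_weightedIntegrand (hM : RegularMatrixField M)
    (hMΘ : ∀ x t, 0 ≤ t → M x t = (Θ x t)ᵀ * Θ x t) {t : ℝ} (ht : 0 ≤ t) :
    IsLengthIntegrand (weightedIntegrand Θ t) where
  continuous := by
    simp only [weightedIntegrand_eq_sqrt (hMΘ _ t ht)]
    refine Real.continuous_sqrt.comp (continuousOn_univ.1 (continuousOn_dotProduct_mulVec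
      (by fun_prop) (fun i j => ?_) (by fun_prop)))
    exact (hM i j).continuousOn.comp (f := fun p : State n × State n => ((p.1, t) : State n × ℝ))
      (by fun_prop) fun p _ => mk_mem_stateTime ht
  nonneg _ _ := norm_nonneg _
  smul r hr x v := by
    rw [weightedIntegrand, WithLp.ofLp_smul, Matrix.mulVec_smul, WithLp.toLp_smul, norm_smul,
      Real.norm_of_nonneg hr, weightedIntegrand]

theorem weightedIntegrand_le {t ω : ℝ} {x : State n} (hMΘ : M x t = (Θ x t)ᵀ * Θ x t)
    (hupper : M x t ≤ (1 / ω) • (1 : Matrix (Fin n) (Fin n) ℝ)) (v : State n) :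
    weightedIntegrand Θ t x v ≤ √(1 / ω) * ‖v‖ := by
  rw [weightedIntegrand_eq_sqrt hMΘ, ← Real.sqrt_sq (norm_nonneg v),
    ← Real.sqrt_mul' _ (sq_nonneg _), ← dotProduct_smul_one_mulVec]
  exact Real.sqrt_le_sqrt (dotProduct_mulVec_mono hupper _)

theorem norm_le_weightedIntegrand {t ω : ℝ} (hω : 0 < ω) {x : State n}
    (hMΘ : M x t = (Θ x t)ᵀ * Θ x t)
    (hlower : (1 / ω) • (1 : Matrix (Fin n) (Fin n) ℝ) ≤ M x t) (v : State n) :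
    ‖v‖ ≤ √ω * weightedIntegrand Θ t x v := by
  have h := dotProduct_mulVec_mono hlower v.ofLp
  rw [dotProduct_smul_one_mulVec, one_div_mul_eq_div, div_le_iff₀' hω] at h
  rw [weightedIntegrand_eq_sqrt hMΘ, ← Real.sqrt_mul hω.le]
  exact Real.le_sqrt_of_sq_le h

theorem RegularField.contDiff (hf : RegularField f) {t : ℝ} (ht : 0 ≤ t) :
    ContDiff ℝ 1 (fun x => f x t) :=
  contDiff_one_iff_fderiv.2 ⟨hf.differentiable t ht, continuousOn_univ.1
    (hf.continuousOn_fderiv.comp (f := fun x : State n => ((x, t) : State n × ℝ)) (by fun_prop)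
      fun _ _ => mk_mem_stateTime ht)⟩

theorem IsPath.eulerStep (hf : RegularField f) {t : ℝ} (ht : 0 ≤ t) (s : ℝ) {a b : State n}
    {γ : ℝ → State n} (hγ : IsPath a b γ) :
    IsPath (a + s • f a t) (b + s • f b t) (fun μ => γ μ + s • f (γ μ) t) where
  contDiffOn := hγ.contDiffOn.add (((hf.contDiff ht).comp_contDiffOn hγ.contDiffOn).const_smul s)
  source := by simp [hγ.source]
  target := by simp [hγ.target]

theorem IsPath.derivWithin_eulerStep (hf : RegularField f) {t : ℝ} (ht : 0 ≤ t) (s : ℝ)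
    {a b : State n} {γ : ℝ → State n} (hγ : IsPath a b γ) {μ : ℝ} (hμ : μ ∈ Icc (0 : ℝ) 1) :
    derivWithin (fun μ => γ μ + s • f (γ μ) t) (Icc 0 1) μ
      = derivWithin γ (Icc 0 1) μ
        + s • fderiv ℝ (fun y => f y t) (γ μ) (derivWithin γ (Icc 0 1) μ) := by
  have h := hγ.hasDerivWithinAt hμ
  exact (h.add (((hf.differentiable t ht (γ μ)).hasFDerivAt.comp_hasDerivWithinAt μ
    h).const_smul s)).derivWithin (uniqueDiffOn_Icc zero_lt_one μ hμ)

theorem IsPath.pathIntegral_eulerStep_le (hf : RegularField f) (hM : RegularMatrixField M)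
    (hMΘ : ∀ x t, 0 ≤ t → M x t = (Θ x t)ᵀ * Θ x t) {t s β : ℝ} (ht : 0 ≤ t) (hs : 0 ≤ s)
    (hβs : β * s ≤ 1) {a b : State n} {γ : ℝ → State n} (hγ : IsPath a b γ)
    (hE : ∀ μ ∈ Icc (0 : ℝ) 1, ∀ v,
      eulerEnergy f M (γ μ) t v s ≤ (1 - 2 * β * s) * (v.ofLp ⬝ᵥ M (γ μ) t *ᵥ v.ofLp)) :
    pathIntegral (weightedIntegrand Θ (t + s)) (fun μ => γ μ + s • f (γ μ) t)
      ≤ (1 - β * s) * pathIntegral (weightedIntegrand Θ t) γ := by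
  rw [pathIntegral, pathIntegral, ← intervalIntegral.integral_const_mul]
  have hts := add_nonneg ht hs
  refine intervalIntegral.integral_mono_on zero_le_one
    ((hγ.eulerStep hf ht s).intervalIntegrable_integrand
      (isLengthIntegrand_weightedIntegrand hM hMΘ hts))
    ((hγ.intervalIntegrable_integrand
      (isLengthIntegrand_weightedIntegrand hM hMΘ ht)).const_mul _) fun μ hμ => ?_
  rw [hγ.derivWithin_eulerStep hf ht s hμ, weightedIntegrand_eq_sqrt (hMΘ _ _ hts)]
  -- As `β * s ≤ 1`, the right side is nonnegative and may be squared; then `1 - 2βs ≤ (1 - βs)²`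
  -- suffices.
  refine Real.sqrt_le_iff.2 ⟨mul_nonneg (by linarith) (norm_nonneg _), ?_⟩
  refine (hE μ hμ _).trans ?_
  set v := derivWithin γ (Icc 0 1) μ
  have hq : 0 ≤ v.ofLp ⬝ᵥ M (γ μ) t *ᵥ v.ofLp := by
    rw [← weightedIntegrand_sq (hMΘ _ _ ht)]
    positivity
  rw [mul_pow, weightedIntegrand_sq (hMΘ _ _ ht)]
  exact mul_le_mul_of_nonneg_right (by nlinarith [sq_nonneg (β * s)]) hq

/-! ### Euler error of solutions, and a discrete Grönwall inequality -/

namespace IsSolution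

variable {d x : ℝ → State n}

theorem continuousOn_Icc (hx : IsSolution f d x) {T : ℝ} (hT : 0 ≤ T) :
    ContinuousOn x (Icc 0 T) := by
  have hint := (hx T hT).1
  have h := (intervalIntegral.continuousOn_primitive_interval
    ((intervalIntegrable_iff' (by simp)).1 hint)).const_add (x 0)
  rw [uIcc_of_le hT] at h
  exact h.congr fun t ht => (hx t ht.1).2

theorem sub_eq_integral (hx : IsSolution f d x) {s t : ℝ} (hs : 0 ≤ s) (ht : 0 ≤ t) :
    x t - x s = ∫ r in s..t, (f (x r) r + d r) := by
  rw [(hx t ht).2, (hx s hs).2, add_sub_add_left_eq_sub,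
    intervalIntegral.integral_interval_sub_left (hx t ht).1 (hx s hs).1]

/-- The error of an Euler step of the unperturbed system against a solution of the perturbed
system, uniformly on bounded time intervals. -/
theorem exists_norm_sub_eulerStep_le (hf : RegularField f) (hx : IsSolution f d x) {D : ℝ}
    (hd : ∀ t, 0 ≤ t → ‖d t‖ ≤ D) {T : ℝ} (hT : 0 ≤ T) {η : ℝ} (hη : 0 < η) :
    ∃ δ > 0, ∀ t ∈ Icc 0 T, ∀ s ∈ Icc 0 δ,
      ‖x (t + s) - (x t + s • f (x t) t)‖ ≤ s * (D + η) := by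
  -- The margin `1` leaves room for a step that starts at `T`. Only `f` along `x` is continuous; `d`
  -- enters through its bound alone.
  have hc : ContinuousOn (fun t => f (x t) t) (Icc 0 (T + 1)) :=
    hf.continuousOn.comp (f := fun t => ((x t, t) : State n × ℝ))
      ((hx.continuousOn_Icc (by linarith)).prodMk continuousOn_id)
      fun t ht => mk_mem_stateTime ht.1
  obtain ⟨δ, hδ, huc⟩ := Metric.uniformContinuousOn_iff.1
    (isCompact_Icc.uniformContinuousOn_of_continuous hc) η hη
  refine ⟨min 1 (δ / 2), by positivity, fun t ht s hs => ?_⟩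
  have hs1 : s ≤ 1 := hs.2.trans (min_le_left _ _)
  have hsδ : s ≤ δ / 2 := hs.2.trans (min_le_right _ _)
  have hts : 0 ≤ t + s := add_nonneg ht.1 hs.1
  have hint : IntervalIntegrable (fun r => f (x r) r + d r) volume t (t + s) :=
    (hx t ht.1).1.symm.trans (hx (t + s) hts).1
  have heq : x (t + s) - (x t + s • f (x t) t)
      = ∫ r in t..(t + s), (f (x r) r + d r - f (x t) t) := by
    rw [intervalIntegral.integral_sub hint (by simp), ← hx.sub_eq_integral ht.1 hts]
    simp [sub_sub]
  rw [heq]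
  refine (intervalIntegral.norm_integral_le_of_norm_le_const (C := D + η) fun r hr => ?_).trans_eq
    (by rw [add_sub_cancel_left, abs_of_nonneg hs.1, mul_comm])
  rw [uIoc_of_le (by linarith [hs.1])] at hr
  have hr0 : 0 ≤ r := ht.1.trans hr.1.le
  have hclose := huc r ⟨hr0, by linarith [hr.2, ht.2]⟩ t ⟨ht.1, by linarith [ht.2]⟩ (by
    rw [Real.dist_eq, abs_of_pos (sub_pos.2 hr.1)]
    linarith [hr.2])
  rw [dist_eq_norm] at hclose
  calc ‖f (x r) r + d r - f (x t) t‖ = ‖d r + (f (x r) r - f (x t) t)‖ := by congr 1; abel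
    _ ≤ ‖d r‖ + ‖f (x r) r - f (x t) t‖ := norm_add_le _ _
    _ ≤ D + η := add_le_add (hd r hr0) hclose.le

end IsSolution

/-- A discrete Grönwall inequality: a function that decays at rate `β` up to a drift `c` over all
short steps satisfies the corresponding exponential bound. -/
theorem le_of_forall_short_step {r : ℝ → ℝ} {β c T δ : ℝ} (hT : 0 ≤ T) (hβ : 0 < β) (hδ : 0 < δ)
    (hstep : ∀ t ∈ Icc 0 T, ∀ s ∈ Icc 0 δ, r (t + s) ≤ (1 - β * s) * r t + s * c) :
    r T ≤ (r 0 - c / β) * Real.exp (-(β * T)) + c / β := by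
  have hlim : Filter.Tendsto (fun N : ℕ => (1 + -(β * T) / N) ^ N * (r 0 - c / β) + c / β)
      Filter.atTop (nhds (Real.exp (-(β * T)) * (r 0 - c / β) + c / β)) :=
    ((Real.tendsto_one_add_div_pow_exp _).mul_const _).add_const _
  rw [mul_comm]
  refine ge_of_tendsto hlim ?_
  -- `[0, T]` is cut into `N` equal steps: `N ≥ T / δ` makes them admissible, `N ≥ β * T` makes the
  -- factor `1 - β * (T / N)` nonnegative.
  obtain ⟨N₀, hN₀⟩ := exists_nat_ge (max (T / δ) (β * T))
  filter_upwards [Filter.eventually_ge_atTop (N₀ + 1)] with N hN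
  have hN₀N : (N₀ : ℝ) + 1 ≤ N := by exact_mod_cast hN
  have hNpos : (0 : ℝ) < N := by linarith [N₀.cast_nonneg (α := ℝ)]
  have hs0 : 0 ≤ T / N := by positivity
  have hsδ : T / N ≤ δ := by
    have := (le_max_left _ _).trans hN₀
    rw [div_le_iff₀ hδ] at this
    rw [div_le_iff₀ hNpos]
    nlinarith
  have hβs : β * (T / N) ≤ 1 := by
    have := (le_max_right _ _).trans hN₀
    rw [← mul_div_assoc, div_le_one hNpos]
    linarith
  -- Subtracting the fixed point `c / β` makes the affine recursion geometric.
  have hind (k : ℕ) (hk : k ≤ N) :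
      r (k * (T / N)) - c / β ≤ (1 - β * (T / N)) ^ k * (r 0 - c / β) := by
    induction k with
    | zero => simp
    | succ k ih =>
      have hkN : (k : ℝ) ≤ N := by exact_mod_cast (Nat.le_succ k).trans hk
      have hkT : (k : ℝ) * (T / N) ≤ T := by
        rw [mul_div_assoc', div_le_iff₀ hNpos]
        nlinarith
      have h := hstep (k * (T / N)) ⟨by positivity, hkT⟩ (T / N) ⟨hs0, hsδ⟩
      have h' := mul_le_mul_of_nonneg_left (ih ((Nat.le_succ k).trans hk)) (sub_nonneg.2 hβs)
      have hc : β * (T / N) * (c / β) = T / N * c := by field_simp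
      rw [Nat.cast_succ, add_one_mul, pow_succ']
      linarith
  have h := hind N le_rfl
  rw [mul_div_cancel₀ _ hNpos.ne'] at h
  rw [neg_div, mul_div_assoc, ← sub_eq_add_neg]
  linarith

end Contraction

/-! ### Decay of the weighted distance and the final bounds -/

namespace Contraction

variable {n : ℕ} {f : State n → ℝ → State n} {M Θ : State n → ℝ → Matrix (Fin n) (Fin n) ℝ}

/-- Over short steps, uniformly on `[0, T]`, the weighted distance between a solution of the
unperturbed system and one of the perturbed system contracts at a rate arbitrarily close to `α`,
up to the drift that the perturbation causes. -/
theorem exists_R_add_le (hf : RegularField f) (hM : RegularMatrixField M)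
    (hMΘ : ∀ x t, 0 ≤ t → M x t = (Θ x t)ᵀ * Θ x t) {α ωlow ωhigh : ℝ} (hα : 0 < α)
    (hωhigh : 0 < ωhigh)
    (hcontr : ∀ x t, 0 ≤ t →
      totalDeriv f M x t + sym (M x t * jacobian f x t) ≤ -(2 * α) • M x t)
    (hlower : ∀ x t, 0 ≤ t → (1 / ωhigh) • (1 : Matrix (Fin n) (Fin n) ℝ) ≤ M x t)
    (hupper : ∀ x t, 0 ≤ t → M x t ≤ (1 / ωlow) • (1 : Matrix (Fin n) (Fin n) ℝ))
    {d x₁ x₂ : ℝ → State n} (hx₁ : IsSolution f (fun _ => 0) x₁) (hx₂ : IsSolution f d x₂)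
    {D : ℝ} (hd : ∀ t, 0 ≤ t → ‖d t‖ ≤ D) {T : ℝ} (hT : 0 ≤ T) {η : ℝ} (hη : 0 < η) :
    ∃ δ > 0, ∀ t ∈ Icc 0 T, ∀ s ∈ Icc 0 δ,
      R Θ x₁ x₂ (t + s)
        ≤ (1 - (α - η) * s) * R Θ x₁ x₂ t + s * (√(1 / ωlow) * (D + 2 * η)) := by
  obtain ⟨B₁, hB₁⟩ := isCompact_Icc.exists_bound_of_continuousOn (hx₁.continuousOn_Icc hT)
  obtain ⟨B₂, hB₂⟩ := isCompact_Icc.exists_bound_of_continuousOn (hx₂.continuousOn_Icc hT)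
  have hsymm (x : State n) (t : ℝ) (ht : 0 ≤ t) : (M x t)ᵀ = M x t := by
    rw [hMΘ x t ht, Matrix.transpose_mul, Matrix.transpose_transpose]
  -- The ball contains every path used below: it starts within `B₁` of the origin, and its weighted
  -- length is below `R + 1`, where `R` is bounded by the length of the segment.
  obtain ⟨δ₀, hδ₀, hE⟩ := exists_eulerEnergy_le hf hM hsymm hωhigh hcontr hlower
    (isCompact_closedBall (0 : State n) (B₁ + √ωhigh * (√(1 / ωlow) * (B₂ + B₁) + 1))) T hη
  obtain ⟨δ₁, hδ₁, h₁⟩ := hx₁.exists_norm_sub_eulerStep_le hf (D := 0) (by simp) hT hη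
  obtain ⟨δ₂, hδ₂, h₂⟩ := hx₂.exists_norm_sub_eulerStep_le hf hd hT hη
  -- The bound `1 / α` keeps `1 - (α - η) * s` nonnegative.
  refine ⟨min (1 / α) (min δ₀ (min δ₁ δ₂)), by positivity, fun t ht s hs => ?_⟩
  have hsα : s ≤ 1 / α := hs.2.trans (min_le_left _ _)
  have hs' : s ≤ min δ₀ (min δ₁ δ₂) := hs.2.trans (min_le_right _ _)
  have hs₀ : s ∈ Icc 0 δ₀ := ⟨hs.1, hs'.trans (min_le_left _ _)⟩
  have hs₁ : s ∈ Icc 0 δ₁ := ⟨hs.1, hs'.trans ((min_le_right _ _).trans (min_le_left _ _))⟩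
  have hs₂ : s ∈ Icc 0 δ₂ := ⟨hs.1, hs'.trans ((min_le_right _ _).trans (min_le_right _ _))⟩
  have hβs : (α - η) * s ≤ 1 := by
    rw [le_div_iff₀ hα] at hsα
    nlinarith [hs.1]
  have hts := add_nonneg ht.1 hs.1
  have hN := isLengthIntegrand_weightedIntegrand (Θ := Θ) hM hMΘ ht.1
  have hNs := isLengthIntegrand_weightedIntegrand (Θ := Θ) hM hMΘ hts
  have hRt : R Θ x₁ x₂ t ≤ √(1 / ωlow) * (B₂ + B₁) :=
    (smallestPathIntegral_le_mul_norm hN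
      (fun x v => weightedIntegrand_le (hMΘ x t ht.1) (hupper x t ht.1) v) _ _).trans
      (mul_le_mul_of_nonneg_left
        ((norm_sub_le _ _).trans (add_le_add (hB₂ t ht) (hB₁ t ht))) (Real.sqrt_nonneg _))
  have hshort (a b : State n) :
      smallestPathIntegral (weightedIntegrand Θ (t + s)) a b ≤ √(1 / ωlow) * ‖b - a‖ :=
    smallestPathIntegral_le_mul_norm hNs
      (fun x v => weightedIntegrand_le (hMΘ x _ hts) (hupper x _ hts) v) a b
  have hmiddle : smallestPathIntegral (weightedIntegrand Θ (t + s))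
      (x₁ t + s • f (x₁ t) t) (x₂ t + s • f (x₂ t) t) ≤ (1 - (α - η) * s) * R Θ x₁ x₂ t := by
    -- The infimum need not be attained, so the estimate is proved for `r` slightly above it and `r`
    -- then decreases to it.
    have hpath {r : ℝ} (hr : R Θ x₁ x₂ t < r) (hr1 : r ≤ R Θ x₁ x₂ t + 1) :
        smallestPathIntegral (weightedIntegrand Θ (t + s))
          (x₁ t + s • f (x₁ t) t) (x₂ t + s • f (x₂ t) t) ≤ (1 - (α - η) * s) * r := by
      obtain ⟨γ, hγ, hlt⟩ := exists_isPath_pathIntegral_lt hr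
      have hlen : pathIntegral (euclideanIntegrand n) γ
          ≤ √ωhigh * (√(1 / ωlow) * (B₂ + B₁) + 1) :=
        (hγ.pathIntegral_mono isLengthIntegrand_euclideanIntegrand hN fun x v =>
          norm_le_weightedIntegrand hωhigh (hMΘ x t ht.1) (hlower x t ht.1) v).trans
          (mul_le_mul_of_nonneg_left (by linarith) (Real.sqrt_nonneg _))
      refine (smallestPathIntegral_le hNs (hγ.eulerStep hf ht.1 s)).trans
        ((hγ.pathIntegral_eulerStep_le hf hM hMΘ ht.1 hs.1 hβs fun μ hμ v =>
          hE t ht (γ μ) ?_ v s hs₀).trans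
          (mul_le_mul_of_nonneg_left hlt.le (sub_nonneg.2 hβs)))
      rw [mem_closedBall_zero_iff, ← add_sub_cancel (x₁ t) (γ μ)]
      exact (norm_add_le _ _).trans
        (add_le_add (hB₁ t ht) ((hγ.norm_sub_le hμ).trans hlen))
    have hlim : Filter.Tendsto (fun r => (1 - (α - η) * s) * r)
        (nhdsWithin (R Θ x₁ x₂ t) (Ioi (R Θ x₁ x₂ t)))
        (nhds ((1 - (α - η) * s) * R Θ x₁ x₂ t)) :=
      ((continuous_const.mul continuous_id).tendsto _).mono_left nhdsWithin_le_nhds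
    refine ge_of_tendsto hlim ?_
    filter_upwards [Ioc_mem_nhdsGT (lt_add_one (R Θ x₁ x₂ t))] with r hr using hpath hr.1 hr.2
  -- The two endpoint errors, `η` for `x₁` and `D + η` for `x₂`, add up to the drift `D + 2 * η`.
  have hstart := (hshort (x₁ (t + s)) (x₁ t + s • f (x₁ t) t)).trans
    (mul_le_mul_of_nonneg_left ((norm_sub_rev _ _).trans_le (h₁ t ht s hs₁))
      (Real.sqrt_nonneg _))
  have hend := (hshort (x₂ t + s • f (x₂ t) t) (x₂ (t + s))).trans
    (mul_le_mul_of_nonneg_left (h₂ t ht s hs₂) (Real.sqrt_nonneg _))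
  have htri₁ := smallestPathIntegral_triangle hNs (x₁ (t + s)) (x₁ t + s • f (x₁ t) t)
    (x₂ (t + s))
  have htri₂ := smallestPathIntegral_triangle hNs (x₁ t + s • f (x₁ t) t)
    (x₂ t + s • f (x₂ t) t) (x₂ (t + s))
  rw [R]
  linarith

/-- Grönwall at rate `α - η` gives the bound for each small `η > 0`, and its right side is
continuous at `η = 0`. -/
theorem R_le (hf : RegularField f) (hM : RegularMatrixField M)
    (hMΘ : ∀ x t, 0 ≤ t → M x t = (Θ x t)ᵀ * Θ x t) {α ωlow ωhigh : ℝ} (hα : 0 < α)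
    (hωhigh : 0 < ωhigh)
    (hcontr : ∀ x t, 0 ≤ t →
      totalDeriv f M x t + sym (M x t * jacobian f x t) ≤ -(2 * α) • M x t)
    (hlower : ∀ x t, 0 ≤ t → (1 / ωhigh) • (1 : Matrix (Fin n) (Fin n) ℝ) ≤ M x t)
    (hupper : ∀ x t, 0 ≤ t → M x t ≤ (1 / ωlow) • (1 : Matrix (Fin n) (Fin n) ℝ))
    {d x₁ x₂ : ℝ → State n} (hx₁ : IsSolution f (fun _ => 0) x₁) (hx₂ : IsSolution f d x₂)
    {D : ℝ} (hd : ∀ t, 0 ≤ t → ‖d t‖ ≤ D) {t : ℝ} (ht : 0 ≤ t) :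
    R Θ x₁ x₂ t
      ≤ (R Θ x₁ x₂ 0 - √(1 / ωlow) * D / α) * Real.exp (-(α * t)) + √(1 / ωlow) * D / α := by
  have hcont : ContinuousAt (fun η : ℝ =>
      (R Θ x₁ x₂ 0 - √(1 / ωlow) * (D + 2 * η) / (α - η)) * Real.exp (-((α - η) * t))
        + √(1 / ωlow) * (D + 2 * η) / (α - η)) 0 := by
    have : α - 0 ≠ 0 := by simpa using hα.ne'
    fun_prop (disch := assumption)
  have hlim := hcont.tendsto.mono_left (nhdsWithin_le_nhds (s := Ioi (0 : ℝ)))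
  simp only [mul_zero, add_zero, sub_zero] at hlim
  refine ge_of_tendsto hlim ?_
  filter_upwards [Ioo_mem_nhdsGT hα] with η hη
  obtain ⟨δ, hδ, hstep⟩ := exists_R_add_le hf hM hMΘ hα hωhigh hcontr hlower hupper hx₁ hx₂ hd ht
    hη.1
  exact le_of_forall_short_step ht (sub_pos.2 hη.2) hδ hstep

/-- The square root of a number at least `1` does not exceed it. The order of `ωlow` and `ωhigh` is
asked only when `D ≠ 0`: in dimension zero the bounds on `M` do not compare them, but there the
disturbance vanishes. -/
theorem div_mul_sqrt_le {D α ωlow ωhigh : ℝ} (hα : 0 < α) (hωlow : 0 < ωlow) (hD : 0 ≤ D)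
    (hω : D ≠ 0 → ωlow ≤ ωhigh) :
    D / α * √(ωhigh / ωlow) ≤ D * ωhigh / (α * ωlow) := by
  rcases eq_or_ne D 0 with rfl | hD0
  · simp
  have h1 : 1 ≤ ωhigh / ωlow := (one_le_div hωlow).2 (hω hD0)
  rw [mul_div_mul_comm]
  refine mul_le_mul_of_nonneg_left (Real.sqrt_le_iff.2 ⟨by linarith, ?_⟩) (by positivity)
  exact le_self_pow₀ h1 two_ne_zero

theorem le_of_smul_one_le_smul_one {ωlow ωhigh : ℝ} (hωlow : 0 < ωlow) (hωhigh : 0 < ωhigh)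
    (h : (1 / ωhigh) • (1 : Matrix (Fin n) (Fin n) ℝ) ≤ (1 / ωlow) • 1) {v : State n}
    (hv : v ≠ 0) : ωlow ≤ ωhigh := by
  have h' := dotProduct_mulVec_mono h v.ofLp
  rw [dotProduct_smul_one_mulVec, dotProduct_smul_one_mulVec] at h'
  have hv' : 0 < ‖v‖ := norm_pos_iff.2 hv
  exact (one_div_le_one_div hωhigh hωlow).1 (le_of_mul_le_mul_right h' (by positivity))

end Contraction

theorem theorem1 (n : ℕ)
    (f : Contraction.State n → ℝ → Contraction.State n) (hf : Contraction.RegularField f)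
    (d : ℝ → Contraction.State n) (dbar : ℝ)
    (hd : IsLUB ((fun t => ‖d t‖) '' Set.Ici (0 : ℝ)) dbar)
    (x₁ x₂ : ℝ → Contraction.State n)
    (hx₁ : Contraction.IsSolution f (fun _ => 0) x₁)
    (hx₂ : Contraction.IsSolution f d x₂)
    (M Θ : Contraction.State n → ℝ → Matrix (Fin n) (Fin n) ℝ)
    (hM : Contraction.RegularMatrixField M)
    (hMΘ : ∀ x t, 0 ≤ t → M x t = (Θ x t)ᵀ * Θ x t)
    (hMpos : ∀ x t, 0 ≤ t → (M x t).PosDef)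
    (α ωlow ωhigh : ℝ) (hα : 0 < α) (hωlow : 0 < ωlow) (hωhigh : 0 < ωhigh)
    (hcontr : ∀ x t, 0 ≤ t →
      Contraction.totalDeriv f M x t + Contraction.sym (M x t * Contraction.jacobian f x t)
        ≤ -(2 * α) • M x t)
    (hlower : ∀ x t, 0 ≤ t → (1 / ωhigh) • (1 : Matrix (Fin n) (Fin n) ℝ) ≤ M x t)
    (hupper : ∀ x t, 0 ≤ t → M x t ≤ (1 / ωlow) • (1 : Matrix (Fin n) (Fin n) ℝ)) :
    ∀ t : ℝ, 0 ≤ t →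
      -- the bound on the smallest path integral
      (Contraction.smallestPathIntegral (Contraction.euclideanIntegrand n) (x₁ t) (x₂ t)
            - Contraction.R Θ x₁ x₂ 0 * Real.sqrt ωhigh * Real.exp (-α * t)
          ≤ dbar / α * Real.sqrt (ωhigh / ωlow)) ∧
      (dbar / α * Real.sqrt (ωhigh / ωlow) ≤ dbar * ωhigh / (α * ωlow)) ∧
      -- the same bound for the Euclidean length of any path that realizes `R(t)`
      (∀ γ : ℝ → Contraction.State n, Contraction.IsPath (x₁ t) (x₂ t) γ →
        Contraction.pathIntegral (Contraction.weightedIntegrand Θ t) γ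
            = Contraction.R Θ x₁ x₂ t →
        Contraction.pathIntegral (Contraction.euclideanIntegrand n) γ
            - Contraction.R Θ x₁ x₂ 0 * Real.sqrt ωhigh * Real.exp (-α * t)
          ≤ dbar / α * Real.sqrt (ωhigh / ωlow)) ∧
      -- the tube around the unperturbed trajectory
      x₂ t ∈ Metric.closedBall (x₁ t)
        (Contraction.R Θ x₁ x₂ 0 * Real.sqrt ωhigh * Real.exp (-α * t)
          + dbar / α * Real.sqrt (ωhigh / ωlow)) := by
  intro t ht
  have hd' (s : ℝ) (hs : 0 ≤ s) : ‖d s‖ ≤ dbar := hd.1 ⟨s, hs, rfl⟩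
  have hdbar : 0 ≤ dbar := (norm_nonneg _).trans (hd' 0 le_rfl)
  have hN := Contraction.isLengthIntegrand_weightedIntegrand (Θ := Θ) hM hMΘ ht
  have hdrift : √ωhigh * (√(1 / ωlow) * dbar / α) = dbar / α * √(ωhigh / ωlow) := by
    rw [div_eq_mul_one_div ωhigh, Real.sqrt_mul hωhigh.le]
    ring
  have hR : √ωhigh * Contraction.R Θ x₁ x₂ t
      ≤ Contraction.R Θ x₁ x₂ 0 * √ωhigh * Real.exp (-α * t) + dbar / α * √(ωhigh / ωlow) := by
    have h := mul_le_mul_of_nonneg_left (Contraction.R_le hf hM hMΘ hα hωhigh hcontr hlower hupper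
      hx₁ hx₂ hd' ht) (Real.sqrt_nonneg ωhigh)
    -- `R_le` also subtracts this term, which the stated bound drops.
    have hpos : 0 ≤ dbar / α * √(ωhigh / ωlow) * Real.exp (-(α * t)) := by positivity
    rw [← hdrift] at hpos ⊢
    rw [neg_mul]
    linarith
  have hpath (γ) (hγ : Contraction.IsPath (x₁ t) (x₂ t) γ) :
      Contraction.pathIntegral (Contraction.euclideanIntegrand n) γ
        ≤ √ωhigh * Contraction.pathIntegral (Contraction.weightedIntegrand Θ t) γ :=
    hγ.pathIntegral_mono Contraction.isLengthIntegrand_euclideanIntegrand hN fun x v =>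
      Contraction.norm_le_weightedIntegrand hωhigh (hMΘ x t ht) (hlower x t ht) v
  have hE : Contraction.smallestPathIntegral (Contraction.euclideanIntegrand n) (x₁ t) (x₂ t)
      ≤ √ωhigh * Contraction.R Θ x₁ x₂ t := by
    rw [← div_le_iff₀' (Real.sqrt_pos.2 hωhigh)]
    refine Contraction.le_smallestPathIntegral fun γ hγ => ?_
    rw [div_le_iff₀' (Real.sqrt_pos.2 hωhigh)]
    exact (Contraction.smallestPathIntegral_le
      Contraction.isLengthIntegrand_euclideanIntegrand hγ).trans (hpath γ hγ)
  refine ⟨by linarith, ?_, fun γ hγ hmin => ?_, ?_⟩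
  · refine Contraction.div_mul_sqrt_le hα hωlow hdbar fun hD0 => ?_
    -- If `dbar ≠ 0`, some value of `d` is a nonzero vector, on which the two bounds on `M` can be
    -- compared.
    obtain ⟨s, hs⟩ : ∃ s, d s ≠ 0 := by
      by_contra! h
      refine hD0 (hdbar.antisymm' (hd.2 ?_))
      rintro _ ⟨s, -, rfl⟩
      simp [h s]
    exact Contraction.le_of_smul_one_le_smul_one hωlow hωhigh
      ((hlower 0 0 le_rfl).trans (hupper 0 0 le_rfl)) hs
  · have h := hpath γ hγ
    rw [hmin] at h
    linarith
  · rw [mem_closedBall_iff_norm]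
    exact (Contraction.norm_sub_le_smallestPathIntegral _ _).trans (hE.trans hR)
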